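/- **Model.** A dynamic network on $n$ nodes at times $1,\dots,T$ with $K\ge 1$ subspace change points $1=\tau_0<\tau_1<\cdots<\tau_K<\tau_{K+1}=T$ is given by symmetric matrices $P_t\in[0,1]^{n\times n}$, $t=1,\dots,T$, with $$P_t=\rho\,V^{(k)}M_t(V^{(k)})^{\top}\qquad\text{for } t\in[\tau_{k-1},\tau_k),\ k=1,\dots,K+1$$ (the last segment also contains the time $t=T$), where $\rho=\max_t\|P_t\|_{\max}$ is the sparsity, $V^{(k)}\in\mathbb{R}^{n\times R^{(k)}}$, $R^{(k)}\ge 1$, has orthonormal columns, $M_t\in\mathbb{R}^{R^{(k)}\times R^{(k)}}$ is invertible, and $V^{(k)}(V^{(k)})^\top\neq V^{(k+1)}(V^{(k+1)})^\top$ for $k=1,\dots,K$. Its law $Q$ is the multivariate Bernoulli distribution of symmetric adjacency matrices $A_1,\dots,A_T\in\{0,1\}^{n\times n}$ whose entries $(A_t)_{ij}$, $t\le T$, $i\le j$, are independent with $\mathbb{E}(A_t)_{ij}=(P_t)_{ij}$. Put $\Gamma(Q)=\{\tau_1,\dots,\tau_K\}$, $\Delta_{\min}=\min_{1\le k\le K+1}(\tau_k-\tau_{k-1})$,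 $\delta_{\min}=\min_{1\le k\le K}\|V^{(k+1)}(V^{(k+1)})^\top-V^{(k)}(V^{(k)})^\top\|_F^2$, and $\alpha=n^{-1}\min_t\sigma_{\min}(M_t)$, the largest number with $\sigma_{\min}(M_t)\ge n\alpha$ for all $t$ (so $\alpha\le1$ when $\rho>0$). **Class.** For an integer $r\ge 2$ and constants $\kappa\ge 1$, $0<c\le C$, let $\mathcal{Q}_{n,T}$ be the class of all such networks with $\max_k R^{(k)}\le r$, with balanced singular values $\sigma_{\max}(M_t)\le\kappa\,\sigma_{\min}(M_t)$ for all $t$, and with $$\frac{c}{\log(n+T)}\le n\rho\,\alpha^4\Delta_{\min}\delta_{\min}\le\frac{C}{\log(n+T)}.$$ **Theorem 3.** For all $r\ge2$, $\kappa\ge1$ and $0<c\le C$ there are a constant $c_4>0$ and an $n_0$ such that for all $n\ge n_0$ and all $T\ge 4$ $$\inf_{\check\Gamma}\ \sup_{Q\in\mathcal{Q}_{n,T}}\mathbb{E}_Q\!\left(\frac{H(\check\Gamma,\Gamma(Q))}{\Delta_{\min}(Q)}\right)\ge c_4 ,$$ where the infimum is over all change point estimators, i.e. all maps $\check\Gamma$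 from the observed $(A_1,\dots,A_T)$ to finite sets of times, and $H$ is the Hausdorff distance $$H(\check\Gamma,\Gamma)=\max\Big\{\max_{\tau\in\Gamma}\min_{\tau'\in\check\Gamma}|\tau-\tau'|,\ \max_{\tau'\in\check\Gamma}\min_{\tau\in\Gamma}|\tau-\tau'|\Big\}$$ (infinite if $\check\Gamma=\emptyset$). -/

import Mathlib

open MeasureTheory ProbabilityTheory
open scoped ENNReal Matrix

/-- The times `1, …, T`. -/
abbrev Times (T : ℕ) : Type := Finset.Icc 1 T

/-- The positions on and above the diagonal of an `n × n` matrix; the entries there determine a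
symmetric matrix. -/
abbrev UpperPairs (n : ℕ) : Type := {p : Fin n × Fin n // p.1 ≤ p.2}

/-- The largest singular value of an `R × R` matrix, `R ≥ 1`. (Mathlib lists the singular values in
decreasing order, starting from index `0`.) -/
noncomputable def sigmaMax {R : ℕ} (A : Matrix (Fin R) (Fin R) ℝ) : ℝ :=
  (Matrix.toEuclideanLin A).singularValues 0

/-- The smallest singular value of an `R × R` matrix, `R ≥ 1`. -/
noncomputable def sigmaMin {R : ℕ} (A : Matrix (Fin R) (Fin R) ℝ) : ℝ :=
  (Matrix.toEuclideanLin A).singularValues (R - 1)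

/-- The squared Frobenius norm of a matrix. -/
def frobeniusSq {n : ℕ} (A : Matrix (Fin n) (Fin n) ℝ) : ℝ :=
  ∑ i, ∑ j, A i j ^ 2

/-- The network sparsity `ρ = max_t ‖P_t‖_max` (for matrices with nonnegative entries). -/
noncomputable def sparsity {n T : ℕ} (P : Times T → Matrix (Fin n) (Fin n) ℝ) : ℝ :=
  ⨆ t, ⨆ i, ⨆ j, P t i j

/-- A dynamic network on `n` nodes at times `1, …, T` with subspace change points: symmetric
matrices `P_t` of connection probabilities, times `1 = τ_0 < τ_1 < ⋯ < τ_K < τ_{K+1} = T` with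
`K ≥ 1`, and a factorization `P_t = ρ V⁽ᵏ⁾ M_t (V⁽ᵏ⁾)ᵀ` on the `k`-th segment, where `V⁽ᵏ⁾` has
orthonormal columns, `M_t` is invertible and the column space of `V⁽ᵏ⁾` changes from each segment
to the next. Segments are numbered from `0`: segment `k` is `[τ_k, τ_{k+1})`, and the last segment
also contains the final time `T`. -/
structure DynamicNetwork (n T : ℕ) where
  /-- the connection probabilities -/
  P : Times T → Matrix (Fin n) (Fin n) ℝ
  P_symm : ∀ t, (P t).IsSymm
  P_mem : ∀ t i j, P t i j ∈ unitInterval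
  /-- the number of change points -/
  K : ℕ
  K_pos : 0 < K
  /-- the change points `τ 1, …, τ K`, with the end points `τ 0 = 1` and `τ (K + 1) = T` -/
  τ : Fin (K + 2) → ℕ
  τ_zero : τ 0 = 1
  τ_last : τ (Fin.last (K + 1)) = T
  τ_strictMono : StrictMono τ
  /-- the ranks of the subspaces -/
  R : Fin (K + 1) → ℕ
  R_pos : ∀ k, 0 < R k
  /-- the bases of the subspaces -/
  V : (k : Fin (K + 1)) → Matrix (Fin n) (Fin (R k)) ℝ
  V_orthonormal : ∀ k, (V k)ᵀ * V k = 1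
  V_change : ∀ k : Fin K,
    V k.castSucc * (V k.castSucc)ᵀ ≠ V k.succ * (V k.succ)ᵀ
  /-- the core matrices; only the values `M k t` with `t` in segment `k` matter -/
  M : (k : Fin (K + 1)) → Times T → Matrix (Fin (R k)) (Fin (R k)) ℝ
  M_isUnit : ∀ k (t : Times T),
    τ k.castSucc ≤ t ∧ ((t : ℕ) < τ k.succ ∨ k = Fin.last K) → IsUnit (M k t)
  P_eq : ∀ k (t : Times T),
    τ k.castSucc ≤ t ∧ ((t : ℕ) < τ k.succ ∨ k = Fin.last K) →
      P t = sparsity P • (V k * M k t * (V k)ᵀ)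

namespace DynamicNetwork

variable {n T : ℕ}

/-- Time `t` belongs to segment `k`. -/
def InSegment (Q : DynamicNetwork n T) (k : Fin (Q.K + 1)) (t : Times T) : Prop :=
  Q.τ k.castSucc ≤ t ∧ ((t : ℕ) < Q.τ k.succ ∨ k = Fin.last Q.K)

/-- The network sparsity `ρ`. -/
noncomputable def rho (Q : DynamicNetwork n T) : ℝ := sparsity Q.P

/-- The set `{τ_1, …, τ_K}` of the change points. -/
def changePoints (Q : DynamicNetwork n T) : Set ℝ :=
  Set.range fun k : Fin Q.K => (Q.τ k.castSucc.succ : ℝ)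

/-- The minimum distance `Δ_min` between adjacent change points, end points included. -/
noncomputable def DeltaMin (Q : DynamicNetwork n T) : ℕ :=
  ⨅ k : Fin (Q.K + 1), (Q.τ k.succ - Q.τ k.castSucc)

/-- The minimum change magnitude `δ_min`. -/
noncomputable def deltaMin (Q : DynamicNetwork n T) : ℝ :=
  ⨅ k : Fin Q.K,
    frobeniusSq (Q.V k.succ * (Q.V k.succ)ᵀ - Q.V k.castSucc * (Q.V k.castSucc)ᵀ)

/-- The signal parameter `α = n⁻¹ min_t σ_min(M_t)`, the largest number such that
`σ_min(M_t) ≥ n α` at all times `t`. -/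
noncomputable def alpha (Q : DynamicNetwork n T) : ℝ :=
  (⨅ p : {p : Fin (Q.K + 1) × Times T // Q.InSegment p.1 p.2}, sigmaMin (Q.M p.1.1 p.1.2)) / n

/-- Balanced singular values, with constant `κ`: `σ_max(M_t) ≤ κ σ_min(M_t)` at all times `t`. -/
def Balanced (Q : DynamicNetwork n T) (κ : ℝ) : Prop :=
  ∀ k t, Q.InSegment k t → sigmaMax (Q.M k t) ≤ κ * sigmaMin (Q.M k t)

/-- The joint distribution of the edge indicators: independent over all times and all unordered
pairs of nodes (loops included), the indicator at `(t, i, j)` being Bernoulli with success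
probability `P_t i j`. -/
noncomputable def law (Q : DynamicNetwork n T) : Measure (Times T → UpperPairs n → Bool) :=
  Measure.pi fun t => Measure.pi fun e =>
    bernoulliMeasure true false ⟨Q.P t e.1.1 e.1.2, Q.P_mem t e.1.1 e.1.2⟩

end DynamicNetwork

/-- The symmetric `0`-`1` adjacency matrices `A_t` with given edge indicators. -/
def adjacency {n T : ℕ} (ω : Times T → UpperPairs n → Bool) :
    Times T → Matrix (Fin n) (Fin n) ℕ :=
  fun t i j => if ω t ⟨(min i j, max i j), min_le_max⟩ then 1 else 0

/-- A change point estimator: a map from the observed adjacency matrices to finite sets of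
times. (All such maps are measurable, as there are finitely many possible observations; real
times are allowed.) -/
abbrev Estimator (n T : ℕ) : Type :=
  (Times T → Matrix (Fin n) (Fin n) ℕ) → Finset ℝ

/-- The expected Hausdorff error of an estimator under `Q`, normalized by `Δ_min`, as a number in
`[0, ∞]`. (The empty set has infinite Hausdorff distance to every nonempty set.) -/
noncomputable def normalizedRisk {n T : ℕ} (est : Estimator n T) (Q : DynamicNetwork n T) : ℝ≥0∞ :=
  ∫⁻ ω, Metric.hausdorffEDist (est (adjacency ω) : Set ℝ) Q.changePoints / (Q.DeltaMin : ℝ≥0∞)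
    ∂Q.law

/-- The class of the dynamic networks whose ranks are at most `r`, whose singular values are
balanced with constant `κ`, and for which `n ρ α⁴ Δ_min δ_min` is between `c / log (n + T)` and
`C / log (n + T)`. -/
def networkClass (n T r : ℕ) (κ c C : ℝ) : Set (DynamicNetwork n T) :=
  {Q | (∀ k, Q.R k ≤ r) ∧ Q.Balanced κ ∧
    c / Real.log (n + T) ≤ n * Q.rho * Q.alpha ^ 4 * Q.DeltaMin * Q.deltaMin ∧
    n * Q.rho * Q.alpha ^ 4 * Q.DeltaMin * Q.deltaMin ≤ C / Real.log (n + T)}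

/-! The proof is Le Cam's method with two mixtures. The change occurs either at `1 + d` or at `T -
d`, where `d = ⌊T/4⌋`; in both cases `Δ_min = d`, and the two times are at least `d` apart, so the
normalized losses of any estimator against them add up to at least `1`.

In each network two communities of `m = 2⌊n/4⌋` nodes have edge probability `ρ` inside and `0`
across. The nodes come in pairs of opposite labels, and the pairs carry signs `ε`, multiplied at the
change by a fixed balanced vector `s`. Balance makes the old and new label vectors orthogonal,
whence `δ_min = 2`; the core matrix is `m • 1`, whence `α = m / n` and perfect conditioning. The
lower end of the signal condition then fixes `ρ`, and `T ρ m` is of order `1 / log (n + T)`.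

This is too little signal to detect `ε`. Average over uniform `ε` and compare with independent edges
of the mean probabilities. The likelihood ratios for `ε` and `ε'` have inner product at most `exp (2
T ρ ⟨ε, ε'⟩²)`, whatever the change time, because `s` cancels (`crossLabel_labelsAt_mul`,
`sum_meanDensity_mul_mul_le`). Since `⟨ε, ε'⟩` is a Rademacher sum, this averages to at most `1 + 8
T ρ m` (`sum_exp_mul_sq_signed_sum_le`). By Cauchy–Schwarz (`sum_abs_mixture_sub_le`) both mixtures
are `L¹`-close to the same law, hence overlap, and `quarter_le_of_sum_mul_le` bounds the risk. -/

theorem singularValues_smul_one {R : ℕ} {a : ℝ} (ha : 0 ≤ a) {i : ℕ} (hi : i < R) :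
    (Matrix.toEuclideanLin (a • (1 : Matrix (Fin R) (Fin R) ℝ))).singularValues i = a := by
  set L := Matrix.toEuclideanLin (a • (1 : Matrix (Fin R) (Fin R) ℝ)) with hL
  have hLa : L = a • LinearMap.id := by
    rw [hL, map_smul]
    congr 1
    ext x j
    simp
  have h := L.hasEigenvalue_adjoint_comp_self_sq_singularValues (n := i) (by simpa using hi)
  obtain ⟨v, hv⟩ := h.exists_hasEigenvector
  have h1 := hv.apply_eq_smul
  have hadj : LinearMap.adjoint L = a • LinearMap.id := by
    rw [hLa, map_smulₛₗ]
    simp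
  rw [hadj, hLa] at h1
  simp only [LinearMap.comp_apply, LinearMap.smul_apply, LinearMap.id_apply, smul_smul] at h1
  have h2 := smul_left_injective ℝ hv.2 h1
  rw [← hLa] at h2
  simp only [RCLike.ofReal_real_eq_id, id] at h2
  have h3 := L.singularValues_nonneg i
  nlinarith [sq_nonneg (L.singularValues i - a), sq_nonneg (L.singularValues i + a)]

/-! ### Two-community networks with balanced random labels -/

/-- Some of the `n` nodes are grouped into pairs indexed by `ι`, with a node of sign `1` and a node
of sign `-1` in each pair; the other nodes have sign `0`. The pairing is described through the sums
it gives rise to. -/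
structure SignedPairing (n : ℕ) (ι : Type*) [Fintype ι] where
  sign : Fin n → ℝ
  pair : Fin n → ι
  sign_mem : ∀ i, sign i = 0 ∨ sign i = 1 ∨ sign i = -1
  sum_sign : ∀ g : ι → ℝ, ∑ i, sign i * g (pair i) = 0
  sum_sign_sq : ∀ g : ι → ℝ, ∑ i, sign i ^ 2 * g (pair i) = 2 * ∑ k, g k

theorem exists_signedPairing {n : ℕ} {ι : Type*} [Fintype ι] [Nonempty ι]
    (h : 2 * Fintype.card ι ≤ n) : Nonempty (SignedPairing n ι) := by
  obtain ⟨e⟩ : Nonempty ((ι × ℤˣ) ↪ Fin n) :=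
    -- A pair `k : ι` consists of the images of `(k, 1)` and `(k, -1)`; the unit is the sign of the
    -- node.
    Function.Embedding.nonempty_of_card_le (by simp [Fintype.card_units_int]; omega)
  let σ : Fin n → ℝ := Function.extend e (fun p => ((p.2 : ℤ) : ℝ)) 0
  let π : Fin n → ι := Function.extend e Prod.fst (fun _ => Classical.arbitrary ι)
  have hσ : ∀ p, σ (e p) = ((p.2 : ℤ) : ℝ) := fun p => e.injective.extend_apply _ _ p
  have hπ : ∀ p, π (e p) = p.1 := fun p => e.injective.extend_apply _ _ p
  have hσ0 : ∀ i, i ∉ Set.range e → σ i = 0 := fun i hi =>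
    Function.extend_apply' _ _ _ hi
  have hu : (Finset.univ : Finset ℤˣ) = {1, -1} := rfl
  refine ⟨⟨σ, π, fun i => ?_, fun g => ?_, fun g => ?_⟩⟩
  · by_cases hi : i ∈ Set.range e
    · obtain ⟨p, rfl⟩ := hi
      rw [hσ]
      rcases Int.units_eq_one_or p.2 with h | h <;> simp [h]
    · exact Or.inl (hσ0 i hi)
  · rw [← Fintype.sum_of_injective e e.injective
      (fun p => ((p.2 : ℤ) : ℝ) * g p.1) _ (fun i hi => by simp [hσ0 i hi])
      (fun p => by rw [hσ, hπ]), Fintype.sum_prod_type]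
    simp [hu]
  · rw [← Fintype.sum_of_injective e e.injective
      (fun p => ((p.2 : ℤ) : ℝ) ^ 2 * g p.1) _ (fun i hi => by simp [hσ0 i hi])
      (fun p => by rw [hσ, hπ]), Fintype.sum_prod_type, Finset.mul_sum]
    simp [hu, two_mul]

namespace SignedPairing

variable {n T : ℕ} {ι : Type*} [Fintype ι] (S : SignedPairing n ι)

/-- The community labels `±1` of the paired nodes, `0` for the other nodes. -/
def label (ε : ι → ℤˣ) (i : Fin n) : ℝ := S.sign i * (ε (S.pair i) : ℤ)

theorem units_cast_mul_self (u : ℤˣ) : ((u : ℤ) : ℝ) * ((u : ℤ) : ℝ) = 1 := by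
  rcases Int.units_eq_one_or u with h | h <;> simp [h]

theorem label_sq (ε : ι → ℤˣ) (i : Fin n) : S.label ε i ^ 2 = S.sign i ^ 2 := by
  rw [label, mul_pow, sq ((ε (S.pair i) : ℤ) : ℝ), units_cast_mul_self, mul_one]

theorem sign_pow_four (i : Fin n) : S.sign i ^ 2 * S.sign i ^ 2 = S.sign i ^ 2 := by
  rcases S.sign_mem i with h | h | h <;> simp [h]

theorem sign_sq_mul_label (ε : ι → ℤˣ) (i : Fin n) :
    S.sign i ^ 2 * S.label ε i = S.label ε i := by
  rw [label]
  rcases S.sign_mem i with h | h | h <;> simp [h]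

theorem sum_label (ε : ι → ℤˣ) : ∑ i, S.label ε i = 0 := S.sum_sign fun k => ((ε k : ℤ) : ℝ)

theorem sum_label_mul_label (ε ε' : ι → ℤˣ) :
    ∑ i, S.label ε i * S.label ε' i = 2 * ∑ k, ((ε k : ℤ) : ℝ) * ((ε' k : ℤ) : ℝ) := by
  rw [← S.sum_sign_sq]
  exact Finset.sum_congr rfl fun i _ => by simp only [label]; ring

theorem sum_sq : ∑ i, S.sign i ^ 2 = 2 * (Fintype.card ι : ℝ) := by
  simpa using S.sum_sign_sq fun _ => 1

/-- The connection probabilities of the two communities: `ρ` within and `0` across. -/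
noncomputable def prob (ρ : ℝ) (ε : ι → ℤˣ) : Matrix (Fin n) (Fin n) ℝ :=
  Matrix.of fun i j => ρ / 2 * (S.sign i ^ 2 * S.sign j ^ 2 + S.label ε i * S.label ε j)

theorem prob_mem {ρ : ℝ} (hρ : ρ ∈ unitInterval) (ε : ι → ℤˣ) (i j : Fin n) :
    0 ≤ S.prob ρ ε i j ∧ S.prob ρ ε i j ≤ ρ := by
  obtain ⟨h0, h1⟩ := hρ
  simp only [prob, label, Matrix.of_apply]
  rcases S.sign_mem i with h | h | h <;> rcases S.sign_mem j with h' | h' | h' <;>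
  rcases Int.units_eq_one_or (ε (S.pair i)) with h2 | h2 <;>
  rcases Int.units_eq_one_or (ε (S.pair j)) with h3 | h3 <;>
  simp only [h, h', h2, h3] <;> norm_num <;> linarith

theorem exists_prob_eq [Nonempty ι] (ρ : ℝ) (ε : ι → ℤˣ) : ∃ i, S.prob ρ ε i i = ρ := by
  obtain ⟨i, hi⟩ : ∃ i, S.sign i ≠ 0 := by
    by_contra! h
    have := S.sum_sq
    simp [h] at this
  refine ⟨i, ?_⟩
  have h1 := S.label_sq ε i
  have h2 : S.sign i ^ 2 = 1 := by rcases S.sign_mem i with h | h | h <;> simp [h] at hi ⊢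
  rw [prob, Matrix.of_apply, ← sq (S.label ε i), h1, h2]
  ring

/-- An orthonormal basis of the span of the indicator vectors of the two communities. -/
noncomputable def basis (ε : ι → ℤˣ) : Matrix (Fin n) (Fin 2) ℝ :=
  Matrix.of fun i a => (![S.sign i ^ 2, S.label ε i] : Fin 2 → ℝ) a / √(2 * Fintype.card ι)

/-- The columns are orthogonal because the communities have equal size, i.e. the labels sum to zero;
each has squared length `2 * card ι` before normalization. -/
theorem basis_orthonormal [Nonempty ι] (ε : ι → ℤˣ) : (S.basis ε)ᵀ * S.basis ε = 1 := by
  have hm : (0 : ℝ) < 2 * Fintype.card ι := by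
    have : 0 < Fintype.card ι := Fintype.card_pos
    positivity
  have hs : √(2 * (Fintype.card ι : ℝ)) * √(2 * (Fintype.card ι : ℝ)) = 2 * Fintype.card ι :=
    Real.mul_self_sqrt hm.le
  ext a b
  have key : ∀ f g : Fin n → ℝ, ∑ i, f i / √(2 * (Fintype.card ι : ℝ)) *
      (g i / √(2 * (Fintype.card ι : ℝ))) = (∑ i, f i * g i) / (2 * Fintype.card ι) := by
    intro f g
    rw [Finset.sum_div]
    exact Finset.sum_congr rfl fun i _ => by rw [div_mul_div_comm, hs]
  rw [Matrix.mul_apply]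
  fin_cases a <;> fin_cases b <;>
  simp only [basis, Matrix.transpose_apply, Matrix.of_apply, key]
  · simp [sign_pow_four, sum_sq, hm.ne']
  · simp [sign_sq_mul_label, sum_label]
  · simp [mul_comm (S.label ε _), sign_sq_mul_label, sum_label]
  · simp [← sq, label_sq, sum_sq, hm.ne']

theorem basis_mul_transpose_apply (ε : ι → ℤˣ) (i j : Fin n) :
    (S.basis ε * (S.basis ε)ᵀ) i j =
      (S.sign i ^ 2 * S.sign j ^ 2 + S.label ε i * S.label ε j) / (2 * Fintype.card ι) := by
  have hs : √(2 * (Fintype.card ι : ℝ)) * √(2 * (Fintype.card ι : ℝ)) = 2 * Fintype.card ι :=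
    Real.mul_self_sqrt (by positivity)
  simp only [Matrix.mul_apply, Matrix.transpose_apply, basis, Matrix.of_apply, Fin.sum_univ_two,
    div_mul_div_comm, hs, add_div]
  simp

theorem prob_eq_basis [Nonempty ι] (ρ : ℝ) (ε : ι → ℤˣ) :
    S.prob ρ ε = ρ • (S.basis ε * ((Fintype.card ι : ℝ) • (1 : Matrix (Fin 2) (Fin 2) ℝ)) *
      (S.basis ε)ᵀ) := by
  have hm : (Fintype.card ι : ℝ) ≠ 0 := by exact_mod_cast Fintype.card_ne_zero
  ext i j
  rw [Matrix.mul_smul, Matrix.mul_one, Matrix.smul_mul, Matrix.smul_apply, Matrix.smul_apply,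
    basis_mul_transpose_apply, prob, Matrix.of_apply, smul_eq_mul, smul_eq_mul]
  field_simp

/-- The common first column cancels, leaving the difference of two rank-one projections. The cross
term is the squared inner product of the label vectors, which vanishes by `h`. -/
theorem frobeniusSq_basis_sub [Nonempty ι] (ε ε' : ι → ℤˣ)
    (h : ∑ k, ((ε k : ℤ) : ℝ) * ((ε' k : ℤ) : ℝ) = 0) :
    frobeniusSq (S.basis ε * (S.basis ε)ᵀ - S.basis ε' * (S.basis ε')ᵀ) = 2 := by
  have hm : (Fintype.card ι : ℝ) ≠ 0 := by exact_mod_cast Fintype.card_ne_zero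
  have hrow : ∀ i j, (S.basis ε * (S.basis ε)ᵀ - S.basis ε' * (S.basis ε')ᵀ) i j ^ 2 =
      (S.sign i ^ 2 * S.sign j ^ 2 * 2 -
        2 * ((S.label ε i * S.label ε' i) * (S.label ε j * S.label ε' j))) /
        (2 * Fintype.card ι) ^ 2 := by
    intro i j
    rw [Matrix.sub_apply, basis_mul_transpose_apply, basis_mul_transpose_apply, ← sub_div,
      div_pow]
    congr 1
    have e1 := S.label_sq ε i
    have e2 := S.label_sq ε j
    have e3 := S.label_sq ε' i
    have e4 := S.label_sq ε' j
    linear_combination e1 * S.label ε j ^ 2 + S.sign i ^ 2 * e2 + e3 * S.label ε' j ^ 2 +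
      S.sign i ^ 2 * e4
  have hx : ∑ i, S.label ε i * S.label ε' i = 0 := by rw [sum_label_mul_label, h, mul_zero]
  simp only [frobeniusSq, hrow, ← Finset.sum_div, Finset.sum_sub_distrib, ← Finset.mul_sum,
    ← Finset.sum_mul, hx, S.sum_sq]
  field_simp
  ring

/-- The labels in force at time `t`, when they change from `ε` to `s * ε` at time `τ`. -/
def labelsAt (τ : ℕ) (s ε : ι → ℤˣ) (t : ℕ) : ι → ℤˣ := if t < τ then ε else s * ε

theorem sparsity_prob [Nonempty ι] (hT : 1 ≤ T) {ρ : ℝ} (hρ : ρ ∈ unitInterval)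
    (f : Times T → ι → ℤˣ) :
    sparsity (fun t => S.prob ρ (f t)) = ρ := by
  have : Nonempty (Times T) := ⟨⟨1, by simpa using hT⟩⟩
  obtain ⟨i₀, -⟩ := S.exists_prob_eq ρ 1
  have : Nonempty (Fin n) := ⟨i₀⟩
  apply le_antisymm
  · exact ciSup_le fun t => ciSup_le fun i => ciSup_le fun j => (S.prob_mem hρ _ i j).2
  · let t : Times T := Classical.arbitrary _
    obtain ⟨i, hi⟩ := S.exists_prob_eq ρ (f t)
    calc ρ = S.prob ρ (f t) i i := hi.symm
      _ ≤ ⨆ j, S.prob ρ (f t) i j := le_ciSup (f := fun j => S.prob ρ (f t) i j)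
          (Set.finite_range _).bddAbove i
      _ ≤ ⨆ i, ⨆ j, S.prob ρ (f t) i j :=
          le_ciSup (f := fun i => ⨆ j, S.prob ρ (f t) i j) (Set.finite_range _).bddAbove i
      _ ≤ _ := le_ciSup (f := fun t => ⨆ i, ⨆ j, S.prob ρ (f t) i j)
          (Set.finite_range _).bddAbove t

/-- The network with two communities, in which the labels change from `ε` to `s * ε` at time `τ`. -/
noncomputable def network [Nonempty ι] {ρ : ℝ} (hρ : ρ ∈ unitInterval) {τ : ℕ} (h1 : 1 < τ)
    (hτ : τ < T) {s : ι → ℤˣ} (hs : ∑ k, ((s k : ℤ) : ℝ) = 0) (ε : ι → ℤˣ) :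
    DynamicNetwork n T where
  P t := S.prob ρ (labelsAt τ s ε t)
  P_symm t := by
    ext i j
    simp only [Matrix.transpose_apply, prob, Matrix.of_apply]
    ring
  P_mem t i j :=
    ⟨(S.prob_mem hρ _ i j).1, (S.prob_mem hρ _ i j).2.trans hρ.2⟩
  K := 1
  K_pos := one_pos
  τ := ![1, τ, T]
  τ_zero := rfl
  τ_last := rfl
  τ_strictMono := by
    rw [Fin.strictMono_iff_lt_succ]
    intro i
    fin_cases i
    · exact h1
    · exact hτ
  R _ := 2
  R_pos _ := two_pos
  V k := S.basis (if k = 0 then ε else s * ε)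
  V_orthonormal k := S.basis_orthonormal _
  V_change k h := by
    -- Equal projections would have distance `0` instead of `2`.
    have := S.frobeniusSq_basis_sub ε (s * ε) (by
      simpa [mul_comm ((s _ : ℤ) : ℝ), ← mul_assoc, units_cast_mul_self] using hs)
    fin_cases k
    simp only [Fin.zero_eta, Fin.castSucc_zero, if_true, Fin.succ_zero_eq_one, one_ne_zero,
      if_false] at h
    rw [h, sub_self] at this
    simp [frobeniusSq] at this
  M _ _ := (Fintype.card ι : ℝ) • 1
  M_isUnit _ _ _ := by
    have hm : (Fintype.card ι : ℝ) ≠ 0 := by exact_mod_cast Fintype.card_ne_zero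
    rw [← Algebra.algebraMap_eq_smul_one]
    exact (IsUnit.mk0 _ hm).map (algebraMap ℝ _)
  P_eq k t ht := by
    rw [S.sparsity_prob (by omega) hρ fun t => labelsAt τ s ε t]
    rw [← prob_eq_basis]
    congr 1
    fin_cases k
    · have : (t : ℕ) < τ := by simpa using ht.2
      simp [labelsAt, this]
    · have : ¬ (t : ℕ) < τ := by simpa using ht.1
      simp [labelsAt, this]

section network

variable [Nonempty ι] {ρ : ℝ} (hρ : ρ ∈ unitInterval) {τ : ℕ} (h1 : 1 < τ)
    (hτ : τ < T) {s : ι → ℤˣ} (hs : ∑ k, ((s k : ℤ) : ℝ) = 0) (ε : ι → ℤˣ)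

theorem network_rho : (S.network hρ h1 hτ hs ε).rho = ρ :=
  S.sparsity_prob (by omega) hρ fun t => labelsAt τ s ε t

theorem network_changePoints : (S.network hρ h1 hτ hs ε).changePoints = {(τ : ℝ)} := by
  let _ : Unique (Fin (S.network hρ h1 hτ hs ε).K) := inferInstanceAs (Unique (Fin 1))
  rw [DynamicNetwork.changePoints, Set.range_unique]
  rfl

theorem network_DeltaMin : (S.network hρ h1 hτ hs ε).DeltaMin = min (τ - 1) (T - τ) := by
  have : (S.network hρ h1 hτ hs ε).DeltaMin = ⨅ k : Fin 2, ![τ - 1, T - τ] k := by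
    unfold DynamicNetwork.DeltaMin
    change ⨅ k : Fin 2, _ = _
    congr 1
    ext k
    fin_cases k <;> rfl
  rw [this]
  apply le_antisymm
  · exact le_min (ciInf_le' (fun k : Fin 2 => ![τ - 1, T - τ] k) 0)
      (ciInf_le' (fun k : Fin 2 => ![τ - 1, T - τ] k) 1)
  · refine le_ciInf fun k => ?_
    fin_cases k
    · exact min_le_left _ _
    · exact min_le_right _ _

theorem network_deltaMin : (S.network hρ h1 hτ hs ε).deltaMin = 2 := by
  let _ : Unique (Fin (S.network hρ h1 hτ hs ε).K) := inferInstanceAs (Unique (Fin 1))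
  rw [DynamicNetwork.deltaMin, ciInf_unique]
  refine S.frobeniusSq_basis_sub (s * ε) ε ?_
  simpa [mul_assoc, units_cast_mul_self] using hs

theorem network_alpha : (S.network hρ h1 hτ hs ε).alpha = Fintype.card ι / n := by
  set Q := S.network hρ h1 hτ hs ε with hQ
  have : Nonempty {p : Fin (Q.K + 1) × Times T // Q.InSegment p.1 p.2} :=
    ⟨⟨⟨(0 : Fin 2), ⟨1, by simp; omega⟩⟩, le_rfl, Or.inl h1⟩⟩
  have hσ : ∀ p : {p : Fin (Q.K + 1) × Times T // Q.InSegment p.1 p.2},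
      sigmaMin (Q.M p.1.1 p.1.2) = Fintype.card ι := fun p =>
    singularValues_smul_one (R := 2) (Nat.cast_nonneg _) (i := 1) one_lt_two
  rw [DynamicNetwork.alpha, iInf_congr hσ, ciInf_const]

theorem network_balanced {κ : ℝ} (hκ : 1 ≤ κ) : (S.network hρ h1 hτ hs ε).Balanced κ := by
  intro k t _
  have h0 : sigmaMax ((S.network hρ h1 hτ hs ε).M k t) = Fintype.card ι :=
    singularValues_smul_one (R := 2) (Nat.cast_nonneg _) (i := 0) two_pos
  have h1 : sigmaMin ((S.network hρ h1 hτ hs ε).M k t) = Fintype.card ι :=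
    singularValues_smul_one (R := 2) (Nat.cast_nonneg _) (i := 1) one_lt_two
  rw [h0, h1]
  exact le_mul_of_one_le_left (Nat.cast_nonneg _) hκ

end network

end SignedPairing

/-! ### Exponential moments of squared Rademacher sums -/

/-- Gaussian linearization: the square in the exponent becomes linear in `u` under an integral, so
that independent signs factorize. -/
theorem exp_sq_mul_sqrt_pi (u : ℝ) :
    Real.exp (u ^ 2) * √Real.pi = ∫ z : ℝ, Real.exp (-z ^ 2 + 2 * u * z) := by
  have h1 : ∀ z : ℝ, Real.exp (-z ^ 2 + 2 * u * z) =
      Real.exp (u ^ 2) * Real.exp (-1 * (z - u) ^ 2) := by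
    intro z
    rw [← Real.exp_add]
    congr 1
    ring
  simp_rw [h1]
  rw [integral_const_mul, integral_sub_right_eq_self (fun z => Real.exp (-1 * z ^ 2)) u,
    integral_gaussian, div_one]

theorem integrable_exp_neg_sq_add (u : ℝ) :
    Integrable fun z : ℝ => Real.exp (-z ^ 2 + 2 * u * z) := by
  have h1 : ∀ z : ℝ, Real.exp (-z ^ 2 + 2 * u * z) =
      Real.exp (u ^ 2) * Real.exp (-1 * (z - u) ^ 2) := by
    intro z
    rw [← Real.exp_add]
    congr 1
    ring
  simp_rw [h1]
  exact ((integrable_exp_neg_mul_sq one_pos).comp_sub_right u).const_mul _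

section Rademacher

variable {ι : Type*} [Fintype ι] [DecidableEq ι]

theorem sum_exp_signed_sum (a : ℝ) :
    ∑ ε : ι → ℤˣ, Real.exp (a * ∑ k, ((ε k : ℤ) : ℝ)) =
      Fintype.card (ι → ℤˣ) * Real.cosh a ^ Fintype.card ι := by
  have hu : (Finset.univ : Finset ℤˣ) = {1, -1} := rfl
  have h : ∏ _k : ι, ∑ u : ℤˣ, Real.exp (a * ((u : ℤ) : ℝ)) =
      ∑ ε : ι → ℤˣ, ∏ k, Real.exp (a * ((ε k : ℤ) : ℝ)) := Fintype.prod_sum _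
  simp_rw [Finset.mul_sum, Real.exp_sum, ← h]
  rw [Finset.prod_const, Finset.card_univ, Fintype.card_fun, Fintype.card_units_int, Nat.cast_pow,
    ← mul_pow]
  congr 1
  rw [Real.cosh_eq]
  simp [hu]
  ring

/-- After linearization with `u = (∑ ε) / (2√m)`, the sum over `ε` is a power of `cosh (z / √m)`, at
most `exp (z² / 2)` per sign vector. Half of the Gaussian weight survives, so the integral
converges. -/
theorem sum_exp_sq_signed_sum_le [Nonempty ι] :
    ∑ ε : ι → ℤˣ, Real.exp ((∑ k, ((ε k : ℤ) : ℝ)) ^ 2 / (4 * Fintype.card ι)) ≤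
      2 * Fintype.card (ι → ℤˣ) := by
  have hm : (0 : ℝ) < Fintype.card ι := by exact_mod_cast Fintype.card_pos
  set m : ℝ := (Fintype.card ι : ℝ) with hmdef
  set N : ℝ := (Fintype.card (ι → ℤˣ) : ℝ) with hN
  have hs : √m * √m = m := Real.mul_self_sqrt hm.le
  have hs0 : 0 < √m := Real.sqrt_pos.2 hm
  have hpi : 0 < √Real.pi := Real.sqrt_pos.2 Real.pi_pos
  have hterm : ∀ ε : ι → ℤˣ,
      Real.exp ((∑ k, ((ε k : ℤ) : ℝ)) ^ 2 / (4 * m)) * √Real.pi =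
        ∫ z : ℝ, Real.exp (-z ^ 2 + 2 * ((∑ k, ((ε k : ℤ) : ℝ)) / (2 * √m)) * z) := by
    intro ε
    rw [← exp_sq_mul_sqrt_pi, div_pow, mul_pow, sq √m, hs]
    norm_num
  refine le_of_mul_le_mul_right ?_ hpi
  rw [Finset.sum_mul, Finset.sum_congr rfl fun ε _ => hterm ε,
    ← integral_finsetSum _ fun ε _ => integrable_exp_neg_sq_add _]
  have hle : ∀ z : ℝ,
      ∑ ε : ι → ℤˣ, Real.exp (-z ^ 2 + 2 * ((∑ k, ((ε k : ℤ) : ℝ)) / (2 * √m)) * z) ≤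
        N * Real.exp (-(1 / 2) * z ^ 2) := by
    intro z
    have h1 : ∀ ε : ι → ℤˣ,
        Real.exp (-z ^ 2 + 2 * ((∑ k, ((ε k : ℤ) : ℝ)) / (2 * √m)) * z) =
          Real.exp (-z ^ 2) * Real.exp (z / √m * ∑ k, ((ε k : ℤ) : ℝ)) := by
      intro ε
      rw [← Real.exp_add]
      congr 1
      field_simp
    rw [Finset.sum_congr rfl fun ε _ => h1 ε, ← Finset.mul_sum, sum_exp_signed_sum]
    have h2 : Real.cosh (z / √m) ^ Fintype.card ι ≤ Real.exp (z ^ 2 / 2) := by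
      calc Real.cosh (z / √m) ^ Fintype.card ι
          ≤ Real.exp ((z / √m) ^ 2 / 2) ^ Fintype.card ι :=
            pow_le_pow_left₀ (Real.cosh_pos _).le (Real.cosh_le_exp_half_sq _) _
        _ = Real.exp (z ^ 2 / 2) := by
            rw [← Real.exp_nat_mul, ← hmdef, div_pow, sq √m, hs]
            congr 1
            field_simp
    calc Real.exp (-z ^ 2) * (N * Real.cosh (z / √m) ^ Fintype.card ι)
        ≤ Real.exp (-z ^ 2) * (N * Real.exp (z ^ 2 / 2)) := by gcongr
      _ = N * Real.exp (-(1 / 2) * z ^ 2) := by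
          rw [mul_left_comm, ← Real.exp_add]
          congr 2
          ring
  calc _ ≤ ∫ z : ℝ, N * Real.exp (-(1 / 2) * z ^ 2) :=
        integral_mono (integrable_finsetSum _ fun ε _ => integrable_exp_neg_sq_add _)
          ((integrable_exp_neg_mul_sq (by norm_num)).const_mul _) hle
    _ = N * √(Real.pi / (1 / 2)) := by rw [integral_const_mul, integral_gaussian]
    -- The constant `√2` is rounded up to `2`.
    _ ≤ N * (2 * √Real.pi) := by
        gcongr
        rw [Real.sqrt_le_left (by positivity), mul_pow, Real.sq_sqrt Real.pi_pos.le]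
        linarith [Real.pi_pos]
    _ = 2 * N * √Real.pi := by ring

/-- Convexity of `exp` between `0` and `y` turns the bound `2` at `θ = 1` into `1 + θ`, which tends
to `1` with `θ`, as a chi-square bound requires. -/
theorem sum_exp_mul_sq_signed_sum_le [Nonempty ι] {θ : ℝ} (h0 : 0 ≤ θ) (h1 : θ ≤ 1) :
    ∑ ε : ι → ℤˣ, Real.exp (θ * ((∑ k, ((ε k : ℤ) : ℝ)) ^ 2 / (4 * Fintype.card ι))) ≤
      (1 + θ) * Fintype.card (ι → ℤˣ) := by
  have h : ∀ y : ℝ, Real.exp (θ * y) ≤ (1 - θ) + θ * Real.exp y := by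
    intro y
    have := convexOn_exp.2 (Set.mem_univ 0) (Set.mem_univ y) (sub_nonneg.2 h1) h0 (by ring)
    simpa using this
  calc _ ≤ ∑ ε : ι → ℤˣ, ((1 - θ) +
          θ * Real.exp ((∑ k, ((ε k : ℤ) : ℝ)) ^ 2 / (4 * Fintype.card ι))) :=
        Finset.sum_le_sum fun ε _ => h _
    _ = (1 - θ) * Fintype.card (ι → ℤˣ) +
          θ * ∑ ε : ι → ℤˣ, Real.exp ((∑ k, ((ε k : ℤ) : ℝ)) ^ 2 / (4 * Fintype.card ι)) := by
        rw [Finset.sum_add_distrib, ← Finset.mul_sum, Finset.sum_const, Finset.card_univ,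
          nsmul_eq_mul, mul_comm (1 - θ)]
    _ ≤ (1 - θ) * Fintype.card (ι → ℤˣ) + θ * (2 * Fintype.card (ι → ℤˣ)) := by
        gcongr
        exact sum_exp_sq_signed_sum_le
    _ = _ := by ring

end Rademacher

/-! ### Mixtures, Bernoulli masses and likelihood ratios -/

/-- A mixture of the densities `g * L ε`, whose second moments are controlled, is close to `g`. -/
theorem sum_abs_mixture_sub_le {Ω E : Type*} [Fintype Ω] [Fintype E] [Nonempty E] {g : Ω → ℝ}
    (hg : ∀ ω, 0 ≤ g ω) (hg1 : ∑ ω, g ω = 1) {L : E → Ω → ℝ}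
    (hL : ∀ ε, ∑ ω, g ω * L ε ω = 1) {θ : ℝ}
    (h2 : ∑ ε, ∑ ε', ∑ ω, g ω * (L ε ω * L ε' ω) ≤ (1 + θ) * Fintype.card E ^ 2) :
    ∑ ω, |(∑ ε, g ω * L ε ω) / Fintype.card E - g ω| ≤ √θ := by
  have hN : (0 : ℝ) < Fintype.card E := by exact_mod_cast Fintype.card_pos
  set N : ℝ := (Fintype.card E : ℝ)
  set A : Ω → ℝ := fun ω => (∑ ε, L ε ω) / N with hA
  have e1 : ∀ ω, |(∑ ε, g ω * L ε ω) / N - g ω| = g ω * |A ω - 1| := by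
    intro ω
    rw [← abs_of_nonneg (hg ω), ← abs_mul, abs_of_nonneg (hg ω)]
    congr 1
    rw [hA, ← Finset.mul_sum]
    ring
  have e2 : ∑ ω, g ω * A ω = 1 := by
    have : ∀ ω, g ω * A ω = (∑ ε, g ω * L ε ω) / N := fun ω => by
      rw [hA, ← Finset.mul_sum]; ring
    rw [Finset.sum_congr rfl fun ω _ => this ω, ← Finset.sum_div, Finset.sum_comm,
      Finset.sum_congr rfl fun ε _ => hL ε]
    simp only [Finset.sum_const, Finset.card_univ, nsmul_eq_mul, mul_one]
    exact div_self hN.ne'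
  have e3 : ∑ ω, g ω * A ω ^ 2 ≤ 1 + θ := by
    have : ∀ ω, g ω * A ω ^ 2 = (∑ ε, ∑ ε', g ω * (L ε ω * L ε' ω)) / N ^ 2 := fun ω => by
      simp_rw [hA, div_pow, sq (∑ ε, L ε ω), Finset.sum_mul_sum, ← Finset.mul_sum]
      ring
    rw [Finset.sum_congr rfl fun ω _ => this ω, ← Finset.sum_div, Finset.sum_comm,
      Finset.sum_congr rfl fun ε _ => Finset.sum_comm, div_le_iff₀ (by positivity)]
    exact h2
  -- This is the chi-square divergence of the mixture from `g`.
  have e4 : ∑ ω, g ω * |A ω - 1| ^ 2 ≤ θ := by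
    have : ∀ ω, g ω * |A ω - 1| ^ 2 = g ω * A ω ^ 2 - 2 * (g ω * A ω) + g ω := fun ω => by
      rw [sq_abs]; ring
    rw [Finset.sum_congr rfl fun ω _ => this ω, Finset.sum_add_distrib, Finset.sum_sub_distrib,
      ← Finset.mul_sum, e2, hg1]
    linarith
  rw [Finset.sum_congr rfl fun ω _ => e1 ω]
  apply Real.le_sqrt_of_sq_le
  have hcs := Finset.sum_sq_le_sum_mul_sum_of_sq_le_mul Finset.univ (r := fun ω => g ω * |A ω - 1|)
    (f := g) (g := fun ω => g ω * |A ω - 1| ^ 2) (fun ω _ => hg ω)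
    (fun ω _ => mul_nonneg (hg ω) (sq_nonneg _)) (fun ω _ => (by ring : _ = _).le)
  rw [hg1, one_mul] at hcs
  exact hcs.trans e4

theorem two_mul_sum_upperPairs {n : ℕ} {F : Fin n → Fin n → ℝ} (hs : ∀ i j, F i j = F j i)
    (h0 : ∀ i, F i i = 0) : 2 * ∑ e : UpperPairs n, F e.1.1 e.1.2 = ∑ i, ∑ j, F i j := by
  have h1 : ∑ e : UpperPairs n, F e.1.1 e.1.2 =
      ∑ p : Fin n × Fin n with p.1 ≤ p.2, F p.1 p.2 :=
    (Finset.sum_subtype _ (by simp) fun p : Fin n × Fin n => F p.1 p.2).symm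
  have h2 : ∑ p : Fin n × Fin n with ¬ p.1 ≤ p.2, F p.1 p.2 =
      ∑ p : Fin n × Fin n with p.1 ≤ p.2, F p.1 p.2 := by
    rw [Finset.sum_filter, Finset.sum_filter,
      ← Equiv.sum_comp (Equiv.prodComm (Fin n) (Fin n))]
    refine Finset.sum_congr rfl fun p _ => ?_
    rcases lt_trichotomy p.1 p.2 with h | h | h
    · simp [h, h.le, hs p.1]
    · simp [h, h0]
    · simp [h, h.le]
  rw [← Fintype.sum_prod_type', ← Finset.sum_filter_add_sum_filter_not Finset.univ
    (fun p : Fin n × Fin n => p.1 ≤ p.2), h2, h1, two_mul]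

/-- The probability mass function of the Bernoulli distribution. -/
def bernoulliMass (p : ℝ) (b : Bool) : ℝ := if b then p else 1 - p

theorem bernoulliMass_nonneg {p : ℝ} (h0 : 0 ≤ p) (h1 : p ≤ 1) (b : Bool) :
    0 ≤ bernoulliMass p b := by
  cases b <;> simp [bernoulliMass, h0, h1]

theorem bernoulliMeasure_singleton (p : unitInterval) (b : Bool) :
    bernoulliMeasure true false p {b} = ENNReal.ofReal (bernoulliMass p b) := by
  rw [← ENNReal.ofReal_toReal (measure_ne_top (bernoulliMeasure true false p) {b})]
  congr 1
  change (bernoulliMeasure true false p).real {b} = _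
  cases b <;> simp [bernoulliMass]

theorem DynamicNetwork.law_singleton {n T : ℕ} (Q : DynamicNetwork n T)
    (ω : Times T → UpperPairs n → Bool) :
    Q.law {ω} = ENNReal.ofReal (∏ t, ∏ e, bernoulliMass (Q.P t e.1.1 e.1.2) (ω t e)) := by
  have h0 : ∀ t (e : UpperPairs n), 0 ≤ bernoulliMass (Q.P t e.1.1 e.1.2) (ω t e) :=
    fun t e => bernoulliMass_nonneg (Q.P_mem t _ _).1 (Q.P_mem t _ _).2 _
  rw [DynamicNetwork.law, Measure.pi_singleton,
    ENNReal.ofReal_prod_of_nonneg fun t _ => Finset.prod_nonneg fun e _ => h0 t e]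
  refine Finset.prod_congr rfl fun t _ => ?_
  rw [Measure.pi_singleton, ENNReal.ofReal_prod_of_nonneg fun e _ => h0 t e]
  exact Finset.prod_congr rfl fun e _ => bernoulliMeasure_singleton _ _

theorem sum_prod_prod_eq {α β : Type*} [Fintype α] [Fintype β] [DecidableEq α] [DecidableEq β]
    (f : α → β → Bool → ℝ) :
    ∑ ω : α → β → Bool, ∏ t, ∏ e, f t e (ω t e) = ∏ t, ∏ e, ∑ b, f t e b := by
  simp_rw [Fintype.prod_sum]

/-- The standardized Bernoulli score `φ`, for which `bernoulliMass (p * (1 + z))` is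
`bernoulliMass p * (1 + z * φ)`. -/
noncomputable def bernoulliScore (p : ℝ) (b : Bool) : ℝ := if b then 1 else -(p / (1 - p))

namespace SignedPairing

variable {n T : ℕ} {ι : Type*} [Fintype ι] (S : SignedPairing n ι)

/-- The probability mass function of the law of `network`. -/
noncomputable def density (T : ℕ) (ρ : ℝ) (τ : ℕ) (s ε : ι → ℤˣ)
    (ω : Times T → UpperPairs n → Bool) : ℝ :=
  ∏ t : Times T, ∏ e : UpperPairs n,
    bernoulliMass (S.prob ρ (labelsAt τ s ε t) e.1.1 e.1.2) (ω t e)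

theorem density_nonneg {ρ : ℝ} (hρ : ρ ∈ unitInterval) (τ : ℕ) (s ε : ι → ℤˣ)
    (ω : Times T → UpperPairs n → Bool) : 0 ≤ S.density T ρ τ s ε ω :=
  Finset.prod_nonneg fun _ _ => Finset.prod_nonneg fun _ _ =>
    bernoulliMass_nonneg (S.prob_mem hρ _ _ _).1 ((S.prob_mem hρ _ _ _).2.trans hρ.2) _

theorem sum_density (T : ℕ) (ρ : ℝ) (τ : ℕ) (s ε : ι → ℤˣ) : ∑ ω, S.density T ρ τ s ε ω = 1 := by
  simp only [density]
  rw [sum_prod_prod_eq fun (t : Times T) (e : UpperPairs n) =>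
    bernoulliMass (S.prob ρ (labelsAt τ s ε t) e.1.1 e.1.2)]
  simp [bernoulliMass]

variable [DecidableEq ι]

/-- The products of the labels at two nodes of different pairs. -/
noncomputable def crossLabel (ε : ι → ℤˣ) (i j : Fin n) : ℝ :=
  if S.pair i = S.pair j then 0 else S.label ε i * S.label ε j

/-- The mean of `prob` over uniformly distributed labels. -/
noncomputable def meanProb (ρ : ℝ) (i j : Fin n) : ℝ :=
  ρ / 2 * (S.sign i ^ 2 * S.sign j ^ 2 + if S.pair i = S.pair j then S.sign i * S.sign j else 0)

/-- Within one pair the two copies of `ε` multiply to `1`, so the entry is deterministic; only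
entries between different pairs fluctuate. -/
theorem prob_eq_meanProb_add (ρ : ℝ) (ε : ι → ℤˣ) (i j : Fin n) :
    S.prob ρ ε i j = S.meanProb ρ i j + ρ / 2 * S.crossLabel ε i j := by
  rw [prob, meanProb, crossLabel, Matrix.of_apply]
  split_ifs with h
  · have := units_cast_mul_self (ε (S.pair j))
    rw [label, label, h]
    linear_combination ρ / 2 * S.sign i * S.sign j * this
  · ring

theorem meanProb_mem {ρ : ℝ} (hρ : ρ ∈ unitInterval) (i j : Fin n) :
    0 ≤ S.meanProb ρ i j ∧ S.meanProb ρ i j ≤ 1 := by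
  obtain ⟨h0, h1⟩ := hρ
  simp only [meanProb]
  rcases S.sign_mem i with h | h | h <;> rcases S.sign_mem j with h' | h' | h' <;>
  simp only [h, h'] <;> split_ifs <;> norm_num <;> constructor <;> linarith

/-- Allows the single score at `ρ / 2` to serve every edge: where the mean differs from `ρ / 2`, the
score is multiplied by zero. -/
theorem crossLabel_eq_zero_or (ρ : ℝ) (i j : Fin n) :
    (∀ ε, S.crossLabel ε i j = 0) ∨ S.meanProb ρ i j = ρ / 2 := by
  by_cases h : S.pair i = S.pair j
  · exact Or.inl fun ε => if_pos h
  · rcases S.sign_mem i with hi | hi | hi <;> rcases S.sign_mem j with hj | hj | hj <;>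
    simp [crossLabel, meanProb, label, h, hi, hj]

theorem bernoulliMass_prob {ρ : ℝ} (hρ : ρ ∈ unitInterval) (ε : ι → ℤˣ) (i j : Fin n) (b : Bool) :
    bernoulliMass (S.prob ρ ε i j) b =
      bernoulliMass (S.meanProb ρ i j) b * (1 + S.crossLabel ε i j * bernoulliScore (ρ / 2) b) := by
  rw [prob_eq_meanProb_add]
  rcases S.crossLabel_eq_zero_or ρ i j with h | h
  · simp [h ε]
  · have : 1 - ρ / 2 ≠ 0 := by have := hρ.2; linarith
    rw [h]
    cases b
    · have h' : (2 : ℝ) - ρ ≠ 0 := by have := hρ.2; linarith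
      simp only [bernoulliMass, bernoulliScore, Bool.false_eq_true, if_false]
      field_simp
      ring
    · simp only [bernoulliMass, bernoulliScore, if_true]
      ring

/-- At success probability `p = ρ / 2` the score has mean zero and variance `p / (1 - p)`, so only
the quadratic term survives. -/
theorem sum_bernoulliMass_mul_mul {ρ : ℝ} (hρ : ρ ∈ unitInterval) (ε ε' : ι → ℤˣ) (i j : Fin n) :
    ∑ b, bernoulliMass (S.meanProb ρ i j) b *
      ((1 + S.crossLabel ε i j * bernoulliScore (ρ / 2) b) *
        (1 + S.crossLabel ε' i j * bernoulliScore (ρ / 2) b)) =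
      1 + ρ / 2 / (1 - ρ / 2) * (S.crossLabel ε i j * S.crossLabel ε' i j) := by
  rcases S.crossLabel_eq_zero_or ρ i j with h | h
  · simp [h, bernoulliMass]
  · have : 1 - ρ / 2 ≠ 0 := by have := hρ.2; linarith
    have h' : (2 : ℝ) - ρ ≠ 0 := by have := hρ.2; linarith
    rw [h]
    simp only [Fintype.sum_bool, bernoulliMass, bernoulliScore, Bool.false_eq_true, if_false,
      if_true]
    field_simp
    ring

/-- Restoring the same-pair terms adds only squares and completes the double sum to `(2⟨ε, ε'⟩)²`;
unordered pairs account for half of it. -/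
theorem sum_crossLabel_mul_le (ε ε' : ι → ℤˣ) :
    ∑ e : UpperPairs n, S.crossLabel ε e.1.1 e.1.2 * S.crossLabel ε' e.1.1 e.1.2 ≤
      2 * (∑ k, (((ε * ε') k : ℤ) : ℝ)) ^ 2 := by
  have h := two_mul_sum_upperPairs (n := n)
    (F := fun i j => S.crossLabel ε i j * S.crossLabel ε' i j)
    (fun i j => by
      simp only [crossLabel, eq_comm (a := S.pair i)]
      split_ifs <;> ring)
    (fun i => by simp [crossLabel])
  have h2 : ∑ i, ∑ j, S.crossLabel ε i j * S.crossLabel ε' i j ≤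
      ∑ i, ∑ j, (S.label ε i * S.label ε' i) * (S.label ε j * S.label ε' j) := by
    refine Finset.sum_le_sum fun i _ => Finset.sum_le_sum fun j _ => ?_
    rw [crossLabel, crossLabel]
    split_ifs with hp
    · have e1 := units_cast_mul_self (ε (S.pair j))
      have e2 := units_cast_mul_self (ε' (S.pair j))
      have : (S.label ε i * S.label ε' i) * (S.label ε j * S.label ε' j) =
          (S.sign i * S.sign j) ^ 2 := by
        simp only [label, hp]
        linear_combination (S.sign i * S.sign j) ^ 2 * e1 +
          (S.sign i * S.sign j) ^ 2 * (ε (S.pair j) * ε (S.pair j) : ℝ) * e2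
      rw [this, zero_mul]
      positivity
    · exact (by ring : _ = _).le
  rw [← Finset.sum_mul_sum, sum_label_mul_label] at h2
  simp only [Pi.mul_apply, Units.val_mul, Int.cast_mul]
  linarith

/-- The probability mass function of independent edges with the probabilities `meanProb`. -/
noncomputable def meanDensity (T : ℕ) (ρ : ℝ) (ω : Times T → UpperPairs n → Bool) : ℝ :=
  ∏ t, ∏ e, bernoulliMass (S.meanProb ρ e.1.1 e.1.2) (ω t e)

/-- The likelihood ratio of `density` and `meanDensity`. -/
noncomputable def likelihoodRatio (T : ℕ) (ρ : ℝ) (τ : ℕ) (s ε : ι → ℤˣ)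
    (ω : Times T → UpperPairs n → Bool) : ℝ :=
  ∏ t : Times T, ∏ e : UpperPairs n,
    (1 + S.crossLabel (labelsAt τ s ε t) e.1.1 e.1.2 * bernoulliScore (ρ / 2) (ω t e))

theorem density_eq_mul {ρ : ℝ} (hρ : ρ ∈ unitInterval) (τ : ℕ) (s ε : ι → ℤˣ)
    (ω : Times T → UpperPairs n → Bool) :
    S.density T ρ τ s ε ω = S.meanDensity T ρ ω * S.likelihoodRatio T ρ τ s ε ω := by
  simp only [density, meanDensity, likelihoodRatio, bernoulliMass_prob S hρ,
    Finset.prod_mul_distrib]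

theorem meanDensity_nonneg {ρ : ℝ} (hρ : ρ ∈ unitInterval)
    (ω : Times T → UpperPairs n → Bool) : 0 ≤ S.meanDensity T ρ ω :=
  Finset.prod_nonneg fun _ _ => Finset.prod_nonneg fun _ _ =>
    bernoulliMass_nonneg (S.meanProb_mem hρ _ _).1 (S.meanProb_mem hρ _ _).2 _

theorem sum_meanDensity (T : ℕ) (ρ : ℝ) : ∑ ω, S.meanDensity T ρ ω = 1 := by
  simp only [meanDensity]
  rw [sum_prod_prod_eq fun (_ : Times T) (e : UpperPairs n) =>
    bernoulliMass (S.meanProb ρ e.1.1 e.1.2)]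
  simp [bernoulliMass]

/-- Each of `s (pair i)` and `s (pair j)` occurs twice and squares to `1`. Thus the second moments
do not see when, or how, the labels change. -/
theorem crossLabel_labelsAt_mul (τ : ℕ) (s ε ε' : ι → ℤˣ) (t : ℕ) (i j : Fin n) :
    S.crossLabel (labelsAt τ s ε t) i j * S.crossLabel (labelsAt τ s ε' t) i j =
      S.crossLabel ε i j * S.crossLabel ε' i j := by
  rw [labelsAt, labelsAt]
  split_ifs with ht
  · rfl
  · simp only [crossLabel]
    split_ifs
    · rfl
    · simp only [label, Pi.mul_apply, Units.val_mul, Int.cast_mul]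
      have e1 := units_cast_mul_self (s (S.pair i))
      have e2 := units_cast_mul_self (s (S.pair j))
      have hx : S.sign i * ε (S.pair i) * (S.sign j * ε (S.pair j)) *
          (S.sign i * ε' (S.pair i) * (S.sign j * ε' (S.pair j))) =
          S.sign i ^ 2 * S.sign j ^ 2 * (ε (S.pair i) * ε (S.pair j) *
            (ε' (S.pair i) * ε' (S.pair j))) := by ring
      rw [hx]
      linear_combination (S.sign i ^ 2 * S.sign j ^ 2 * (ε (S.pair i) * ε (S.pair j) *
            (ε' (S.pair i) * ε' (S.pair j)))) * e1 +
        (S.sign i ^ 2 * S.sign j ^ 2 * (ε (S.pair i) * ε (S.pair j) *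
            (ε' (S.pair i) * ε' (S.pair j)))) *
          (s (S.pair i) * s (S.pair i) : ℝ) * e2

theorem sum_meanDensity_mul_mul_le {ρ : ℝ} (hρ : ρ ∈ unitInterval) (τ : ℕ) (s ε ε' : ι → ℤˣ) :
    ∑ ω, S.meanDensity T ρ ω *
      (S.likelihoodRatio T ρ τ s ε ω * S.likelihoodRatio T ρ τ s ε' ω) ≤
      Real.exp (2 * T * ρ * (∑ k, (((ε * ε') k : ℤ) : ℝ)) ^ 2) := by
  have hρ0 := hρ.1
  have hρ1 := hρ.2
  have hlam0 : 0 ≤ ρ / 2 / (1 - ρ / 2) := div_nonneg (by linarith) (by linarith)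
  have hlam : ρ / 2 / (1 - ρ / 2) ≤ ρ := by
    rw [div_le_iff₀ (by linarith)]
    nlinarith
  simp only [meanDensity, likelihoodRatio, ← Finset.prod_mul_distrib]
  rw [sum_prod_prod_eq fun (t : Times T) (e : UpperPairs n) b =>
    bernoulliMass (S.meanProb ρ e.1.1 e.1.2) b *
      ((1 + S.crossLabel (labelsAt τ s ε t) e.1.1 e.1.2 * bernoulliScore (ρ / 2) b) *
        (1 + S.crossLabel (labelsAt τ s ε' t) e.1.1 e.1.2 * bernoulliScore (ρ / 2) b))]
  simp only [S.sum_bernoulliMass_mul_mul hρ, crossLabel_labelsAt_mul]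
  set z : UpperPairs n → ℝ :=
    fun e => S.crossLabel ε e.1.1 e.1.2 * S.crossLabel ε' e.1.1 e.1.2 with hz
  -- Keeps the factors `1 + λ z` nonnegative, where `λ ≤ 1`, so that they can be bounded by
  -- exponentials inside the product.
  have hz1 : ∀ e, -1 ≤ z e := by
    intro e
    simp only [hz, crossLabel]
    split_ifs
    · norm_num
    · have habs : ∀ (η : ι → ℤˣ) i, |S.label η i| ≤ 1 := by
        intro η i
        rw [label]
        rcases S.sign_mem i with h | h | h <;>
        rcases Int.units_eq_one_or (η (S.pair i)) with h2 | h2 <;> simp [h, h2]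
      refine (abs_le.1 ?_).1
      rw [abs_mul, abs_mul, abs_mul]
      exact mul_le_one₀ (mul_le_one₀ (habs _ _) (abs_nonneg _) (habs _ _))
        (mul_nonneg (abs_nonneg _) (abs_nonneg _))
        (mul_le_one₀ (habs _ _) (abs_nonneg _) (habs _ _))
  have hlam1 : ρ / 2 / (1 - ρ / 2) ≤ 1 := hlam.trans hρ1
  rw [Finset.prod_const, Finset.card_univ]
  have hprod : ∏ e, (1 + ρ / 2 / (1 - ρ / 2) * z e) ≤
      Real.exp (ρ * (2 * (∑ k, (((ε * ε') k : ℤ) : ℝ)) ^ 2)) := by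
    calc ∏ e, (1 + ρ / 2 / (1 - ρ / 2) * z e)
        ≤ ∏ e, Real.exp (ρ / 2 / (1 - ρ / 2) * z e) :=
          Finset.prod_le_prod (fun e _ => by nlinarith [hz1 e])
            fun e _ => by rw [add_comm]; exact Real.add_one_le_exp _
      _ = Real.exp (ρ / 2 / (1 - ρ / 2) * ∑ e, z e) := by
          rw [← Real.exp_sum, Finset.mul_sum]
      _ ≤ _ := by
          refine Real.exp_le_exp.2 ?_
          exact (mul_le_mul_of_nonneg_left (S.sum_crossLabel_mul_le ε ε') hlam0).trans
            (mul_le_mul_of_nonneg_right hlam (by positivity))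
  have hprod0 : 0 ≤ ∏ e, (1 + ρ / 2 / (1 - ρ / 2) * z e) :=
    Finset.prod_nonneg fun e _ => by nlinarith [hz1 e]
  refine (pow_le_pow_left₀ hprod0 hprod _).trans ?_
  rw [← Real.exp_nat_mul]
  refine Real.exp_le_exp.2 (le_of_eq ?_)
  have : Fintype.card (Times T) = T := by simp
  rw [this]
  ring

/-- The mixture of the laws of the networks over uniformly distributed labels. -/
noncomputable def mixture (T : ℕ) (ρ : ℝ) (τ : ℕ) (s : ι → ℤˣ)
    (ω : Times T → UpperPairs n → Bool) : ℝ :=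
  (∑ ε, S.density T ρ τ s ε ω) / Fintype.card (ι → ℤˣ)

theorem mixture_nonneg {ρ : ℝ} (hρ : ρ ∈ unitInterval) (τ : ℕ) (s : ι → ℤˣ)
    (ω : Times T → UpperPairs n → Bool) :
    0 ≤ S.mixture T ρ τ s ω :=
  div_nonneg (Finset.sum_nonneg fun _ _ => S.density_nonneg hρ _ _ _ _) (Nat.cast_nonneg _)

theorem sum_mixture (T : ℕ) (ρ : ℝ) (τ : ℕ) (s : ι → ℤˣ) : ∑ ω, S.mixture T ρ τ s ω = 1 := by
  have : (Fintype.card (ι → ℤˣ) : ℝ) ≠ 0 := by exact_mod_cast Fintype.card_ne_zero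
  simp only [mixture]
  rw [← Finset.sum_div, Finset.sum_comm]
  simp only [sum_density, Finset.sum_const, Finset.card_univ, nsmul_eq_mul, mul_one]
  exact div_self this

theorem sum_abs_mixture_sub_meanDensity_le [Nonempty ι] {ρ : ℝ} (hρ : ρ ∈ unitInterval) (τ : ℕ)
    (s : ι → ℤˣ) (hθ : 8 * T * ρ * Fintype.card ι ≤ 1) :
    ∑ ω, |S.mixture T ρ τ s ω - S.meanDensity T ρ ω| ≤ √(8 * T * ρ * Fintype.card ι) := by
  have hρ0 := hρ.1
  have hm : (Fintype.card ι : ℝ) ≠ 0 := by exact_mod_cast Fintype.card_ne_zero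
  simp only [mixture, S.density_eq_mul hρ]
  refine sum_abs_mixture_sub_le (fun ω => S.meanDensity_nonneg hρ ω) (S.sum_meanDensity T ρ)
    (fun ε => ?_) ?_
  · simp only [← S.density_eq_mul hρ, sum_density]
  · calc _ ≤ ∑ ε : ι → ℤˣ, ∑ ε' : ι → ℤˣ,
          Real.exp (2 * T * ρ * (∑ k, (((ε * ε') k : ℤ) : ℝ)) ^ 2) :=
          Finset.sum_le_sum fun ε _ => Finset.sum_le_sum fun ε' _ =>
            S.sum_meanDensity_mul_mul_le hρ τ s ε ε'
      _ = ∑ ε : ι → ℤˣ, ∑ η : ι → ℤˣ,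
          Real.exp (2 * T * ρ * (∑ k, ((η k : ℤ) : ℝ)) ^ 2) :=
          -- For fixed `ε`, the product `η = ε * ε'` runs over all sign vectors.
          Finset.sum_congr rfl fun ε _ => Equiv.sum_comp (Equiv.mulLeft ε) fun η : ι → ℤˣ =>
            Real.exp (2 * T * ρ * (∑ k, ((η k : ℤ) : ℝ)) ^ 2)
      _ = Fintype.card (ι → ℤˣ) * ∑ η : ι → ℤˣ, Real.exp (8 * T * ρ * Fintype.card ι *
            ((∑ k, ((η k : ℤ) : ℝ)) ^ 2 / (4 * Fintype.card ι))) := by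
          rw [Finset.sum_const, Finset.card_univ, nsmul_eq_mul]
          congr 1
          refine Finset.sum_congr rfl fun η _ => ?_
          congr 1
          field_simp
          ring
      _ ≤ Fintype.card (ι → ℤˣ) * ((1 + 8 * T * ρ * Fintype.card ι) *
            Fintype.card (ι → ℤˣ)) := by
          gcongr
          exact sum_exp_mul_sq_signed_sum_le (by positivity) hθ
      _ = _ := by ring

end SignedPairing

/-! ### Le Cam's bound and the two change times -/

/-- The minimum is half of the sum minus half of `|f - f'|`, and the latter is controlled through
`g`. -/
theorem half_le_sum_min {Ω : Type*} [Fintype Ω] {f f' g : Ω → ℝ} (hf : ∑ ω, f ω = 1)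
    (hf' : ∑ ω, f' ω = 1) (h : ∑ ω, |f ω - g ω| ≤ 1 / 2) (h' : ∑ ω, |f' ω - g ω| ≤ 1 / 2) :
    1 / 2 ≤ ∑ ω, min (f ω) (f' ω) := by
  have hmin : ∀ ω, (f ω + f' ω - (|f ω - g ω| + |f' ω - g ω|)) / 2 ≤ min (f ω) (f' ω) := by
    intro ω
    have h1 := le_abs_self (f ω - g ω)
    have h2 := le_abs_self (f' ω - g ω)
    have h3 := neg_abs_le (f ω - g ω)
    have h4 := neg_abs_le (f' ω - g ω)
    exact le_min (by linarith) (by linarith)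
  have hsum := Finset.sum_le_sum fun ω (_ : ω ∈ Finset.univ) => hmin ω
  rw [← Finset.sum_div, Finset.sum_sub_distrib, Finset.sum_add_distrib, Finset.sum_add_distrib,
    hf, hf'] at hsum
  linarith

/-- Le Cam's two-point bound: if the losses against two hypotheses add up to at least `1` and the
two probability mass functions overlap, then one of the risks is large. -/
theorem quarter_le_of_sum_mul_le {Ω : Type*} [Fintype Ω] {f f' : Ω → ℝ} {l l' : Ω → ℝ≥0∞}
    {B : ℝ≥0∞} (h0 : ∀ ω, 0 ≤ f ω) (h0' : ∀ ω, 0 ≤ f' ω)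
    (hmin : 1 / 2 ≤ ∑ ω, min (f ω) (f' ω)) (hl : ∀ ω, 1 ≤ l ω + l' ω)
    (hB : ∑ ω, l ω * ENNReal.ofReal (f ω) ≤ B) (hB' : ∑ ω, l' ω * ENNReal.ofReal (f' ω) ≤ B) :
    ENNReal.ofReal (1 / 4) ≤ B := by
  have h1 : ENNReal.ofReal (1 / 2) ≤ 2 * B := by
    calc ENNReal.ofReal (1 / 2) ≤ ENNReal.ofReal (∑ ω, min (f ω) (f' ω)) :=
          ENNReal.ofReal_le_ofReal hmin
      _ = ∑ ω, 1 * ENNReal.ofReal (min (f ω) (f' ω)) := by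
          simp only [one_mul]
          exact ENNReal.ofReal_sum_of_nonneg fun ω _ => le_min (h0 ω) (h0' ω)
      _ ≤ ∑ ω, (l ω + l' ω) * ENNReal.ofReal (min (f ω) (f' ω)) := by
          gcongr with ω
          exact hl ω
      _ ≤ ∑ ω, (l ω * ENNReal.ofReal (f ω) + l' ω * ENNReal.ofReal (f' ω)) := by
          gcongr with ω
          rw [add_mul]
          gcongr
          · exact min_le_left _ _
          · exact min_le_right _ _
      _ ≤ 2 * B := by
          rw [Finset.sum_add_distrib, two_mul]
          exact add_le_add hB hB'
  have h2 : ENNReal.ofReal (1 / 2) = 2 * ENNReal.ofReal (1 / 4) := by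
    rw [← ENNReal.ofReal_ofNat 2, ← ENNReal.ofReal_mul (by norm_num)]
    norm_num
  rw [h2] at h1
  exact (ENNReal.mul_le_mul_iff_right (by norm_num) (by norm_num)).1 h1

namespace SignedPairing

variable {n T : ℕ} {ι : Type*} [Fintype ι] (S : SignedPairing n ι) [Nonempty ι] {ρ : ℝ}
  (hρ : ρ ∈ unitInterval) {s : ι → ℤˣ} (hs : ∑ k, ((s k : ℤ) : ℝ) = 0)

theorem normalizedRisk_network (est : Estimator n T) {τ : ℕ} (h1 : 1 < τ) (hτ : τ < T)
    (ε : ι → ℤˣ) :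
    normalizedRisk est (S.network hρ h1 hτ hs ε) =
      ∑ ω, Metric.hausdorffEDist (est (adjacency ω) : Set ℝ) {(τ : ℝ)} /
        ((min (τ - 1) (T - τ) : ℕ) : ℝ≥0∞) * ENNReal.ofReal (S.density T ρ τ s ε ω) := by
  rw [normalizedRisk, lintegral_fintype]
  refine Finset.sum_congr rfl fun ω _ => ?_
  rw [network_changePoints, network_DeltaMin, DynamicNetwork.law_singleton]
  rfl

theorem network_mem_networkClass {r : ℕ} (hr : 2 ≤ r) {κ c C : ℝ} (hκ : 1 ≤ κ)
    (hcC : c ≤ C) (hlog : 0 < Real.log (n + T)) {τ : ℕ} (h1 : 1 < τ) (hτ : τ < T)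
    (hc : n * ρ * (Fintype.card ι / n : ℝ) ^ 4 * (min (τ - 1) (T - τ) : ℕ) * 2 =
      c / Real.log (n + T)) (ε : ι → ℤˣ) :
    S.network hρ h1 hτ hs ε ∈ networkClass n T r κ c C := by
  refine ⟨fun _ => hr, S.network_balanced hρ h1 hτ hs ε hκ, ?_⟩
  rw [network_rho, network_alpha, network_DeltaMin, network_deltaMin, hc]
  exact ⟨le_rfl, by gcongr⟩

variable [DecidableEq ι]

/-- The Bayes risk is at most the largest risk. -/
theorem sum_mul_mixture_le (est : Estimator n T) {τ : ℕ} (h1 : 1 < τ) (hτ : τ < T) {B : ℝ≥0∞}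
    (hB : ∀ ε, normalizedRisk est (S.network hρ h1 hτ hs ε) ≤ B) :
    ∑ ω, Metric.hausdorffEDist (est (adjacency ω) : Set ℝ) {(τ : ℝ)} /
        ((min (τ - 1) (T - τ) : ℕ) : ℝ≥0∞) * ENNReal.ofReal (S.mixture T ρ τ s ω) ≤ B := by
  have hN : (0 : ℝ) < Fintype.card (ι → ℤˣ) := by exact_mod_cast Fintype.card_pos
  have hmix : ∀ ω, ENNReal.ofReal (S.mixture T ρ τ s ω) =
      (∑ ε, ENNReal.ofReal (S.density T ρ τ s ε ω)) * (Fintype.card (ι → ℤˣ) : ℝ≥0∞)⁻¹ := by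
    intro ω
    rw [mixture, ENNReal.ofReal_div_of_pos hN, ENNReal.ofReal_natCast, div_eq_mul_inv,
      ENNReal.ofReal_sum_of_nonneg fun ε _ => S.density_nonneg hρ _ _ _ _]
  simp only [hmix, ← mul_assoc, Finset.mul_sum]
  rw [← Finset.sum_mul, Finset.sum_comm]
  simp only [normalizedRisk_network] at hB
  calc _ ≤ (∑ _ε : ι → ℤˣ, B) * (Fintype.card (ι → ℤˣ) : ℝ≥0∞)⁻¹ := by
        gcongr with ε
        exact hB ε
    _ = B := by
        rw [Finset.sum_const, Finset.card_univ, nsmul_eq_mul, mul_comm, ← mul_assoc,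
          ENNReal.inv_mul_cancel (by simp) (ENNReal.natCast_ne_top _), one_mul]

theorem quarter_le_of_normalizedRisk_le (est : Estimator n T) {τ τ' d : ℕ} (h1 : 1 < τ)
    (hτ : τ < T) (h1' : 1 < τ') (hτ' : τ' < T) (hd : min (τ - 1) (T - τ) = d)
    (hd' : min (τ' - 1) (T - τ') = d) (hsep : τ + d ≤ τ') (hd0 : 0 < d)
    (hθ : 8 * T * ρ * Fintype.card ι ≤ 1 / 4) {B : ℝ≥0∞}
    (hB : ∀ ε, normalizedRisk est (S.network hρ h1 hτ hs ε) ≤ B)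
    (hB' : ∀ ε, normalizedRisk est (S.network hρ h1' hτ' hs ε) ≤ B) :
    ENNReal.ofReal (1 / 4) ≤ B := by
  have hsqrt : √(8 * T * ρ * Fintype.card ι) ≤ 1 / 2 :=
    Real.sqrt_le_iff.2 ⟨by norm_num, by linarith⟩
  have hclose := fun τ => (S.sum_abs_mixture_sub_meanDensity_le (T := T) hρ τ s
    (by linarith)).trans hsqrt
  have hr := S.sum_mul_mixture_le hρ hs est h1 hτ hB
  have hr' := S.sum_mul_mixture_le hρ hs est h1' hτ' hB'
  rw [hd] at hr
  rw [hd'] at hr'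
  refine quarter_le_of_sum_mul_le (fun ω => S.mixture_nonneg hρ _ _ _)
    (fun ω => S.mixture_nonneg hρ _ _ _) (half_le_sum_min (S.sum_mixture T ρ τ s)
    (S.sum_mixture T ρ τ' s) (hclose τ) (hclose τ')) (fun ω => ?_) hr hr'
  -- The losses add up to at least `1` by the triangle inequality for the Hausdorff distance and the
  -- separation of the change times.
  rw [ENNReal.div_add_div_same, ENNReal.le_div_iff_mul_le (Or.inl (by simpa using hd0.ne'))
    (Or.inl (ENNReal.natCast_ne_top _)), one_mul]
  calc (d : ℝ≥0∞) ≤ edist (τ : ℝ) (τ' : ℝ) := by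
        rw [edist_dist, Real.dist_eq, ← ENNReal.ofReal_natCast d]
        refine ENNReal.ofReal_le_ofReal ?_
        have : (τ : ℝ) + d ≤ τ' := by exact_mod_cast hsep
        rw [abs_sub_comm]
        exact le_trans (by linarith) (le_abs_self _)
    _ = Metric.hausdorffEDist {(τ : ℝ)} {(τ' : ℝ)} := Metric.hausdorffEDist_singleton.symm
    _ ≤ _ := by
        rw [Metric.hausdorffEDist_comm (s := (est (adjacency ω) : Set ℝ)) (t := {(τ : ℝ)})]
        exact Metric.hausdorffEDist_triangle

end SignedPairing

/-! ### Calibration of the parameters -/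

theorem theorem3 (r : ℕ) (hr : 2 ≤ r) (κ c C : ℝ) (hκ : 1 ≤ κ) (hc : 0 < c) (hcC : c ≤ C) :
    ∃ c₄ : ℝ, 0 < c₄ ∧ ∃ n₀ : ℕ, ∀ n T : ℕ, n₀ ≤ n → 4 ≤ T →
      ENNReal.ofReal c₄ ≤
        ⨅ est : Estimator n T, ⨆ Q ∈ networkClass n T r κ c C, normalizedRisk est Q := by
  refine ⟨1 / 4, by norm_num, max 4 ⌈Real.exp (5000 * c)⌉₊, fun n T hn hT => le_iInf fun est => ?_⟩
  have hn4 : 4 ≤ n := (le_max_left _ _).trans hn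
  have hnexp : Real.exp (5000 * c) ≤ n :=
    (Nat.le_ceil _).trans (by exact_mod_cast (le_max_right _ _).trans hn)
  obtain ⟨q, hq0, hqn, hnq⟩ : ∃ q : ℕ, 0 < q ∧ 4 * q ≤ n ∧ n ≤ 7 * q :=
    ⟨n / 4, by omega, by omega, by omega⟩
  obtain ⟨d, hd0, hdT, hTd⟩ : ∃ d : ℕ, 0 < d ∧ 4 * d ≤ T ∧ T ≤ 7 * d :=
    ⟨T / 4, by omega, by omega, by omega⟩
  have : Nonempty (Fin q) := ⟨⟨0, hq0⟩⟩
  -- The pairs are indexed by `Fin q × ℤˣ` so that the second projection can serve as the balanced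
  -- vector `s`.
  have hcard : Fintype.card (Fin q × ℤˣ) = 2 * q := by
    simp [Fintype.card_units_int, mul_comm]
  obtain ⟨S⟩ := exists_signedPairing (n := n) (ι := Fin q × ℤˣ) (by rw [hcard]; omega)
  have hs : ∑ k : Fin q × ℤˣ, ((k.2 : ℤ) : ℝ) = 0 := by
    have hu : (Finset.univ : Finset ℤˣ) = {1, -1} := rfl
    rw [Fintype.sum_prod_type]
    simp [hu]
  set l := Real.log (n + T) with hl
  have hn0 : (0 : ℝ) < n := by exact_mod_cast (by omega : 0 < n)
  have hl5 : 5000 * c ≤ l := by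
    rw [hl, Real.le_log_iff_exp_le (by positivity)]
    exact hnexp.trans (le_add_of_nonneg_right (Nat.cast_nonneg _))
  have hl0 : 0 < l := lt_of_lt_of_le (by positivity) hl5
  have hq0' : (0 : ℝ) < q := by exact_mod_cast hq0
  have hd0' : (0 : ℝ) < d := by exact_mod_cast hd0
  -- Solves `n ρ (m / n)⁴ d · 2 = c / l` for `ρ`, with `m = 2 * q`.
  set ρ : ℝ := c * n ^ 3 / (2 * (2 * q) ^ 4 * d * l) with hρdef
  have hρ0 : 0 < ρ := by positivity
  have hθ : 8 * T * ρ * Fintype.card (Fin q × ℤˣ) ≤ 1 / 4 := by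
    have hn3 : (n : ℝ) ^ 3 ≤ (7 * q) ^ 3 := by
      gcongr
      exact_mod_cast hnq
    have hT7 : (T : ℝ) ≤ 7 * d := by exact_mod_cast hTd
    calc 8 * T * ρ * Fintype.card (Fin q × ℤˣ)
        = 8 * T * (c * n ^ 3 / (2 * (2 * q) ^ 4 * d * l)) * (2 * q) := by
          rw [hcard, hρdef]; push_cast; ring
      _ ≤ 8 * (7 * d) * (c * (7 * q) ^ 3 / (2 * (2 * q) ^ 4 * d * l)) * (2 * q) := by gcongr
      -- The final bound needs `l ≥ 4802 c`, which is why `n₀` was chosen with `5000 * c`.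
      _ = 1200.5 * c / l := by
          field_simp
          norm_num
      _ ≤ 1 / 4 := by
          rw [div_le_iff₀ hl0]
          linarith
  have hρ : ρ ∈ unitInterval := by
    refine ⟨hρ0.le, ?_⟩
    have h1 : (1 : ℝ) ≤ 8 * T * Fintype.card (Fin q × ℤˣ) := by
      rw [hcard]
      exact_mod_cast Nat.mul_pos (by omega : 0 < 8 * T) (by omega : 0 < 2 * q)
    -- `ρ ≤ 1` follows from `hθ`, since the factor multiplying `ρ` there is at least `1`.
    nlinarith
  have hmem : ∀ {τ : ℕ} (h1 : 1 < τ) (hτ : τ < T), min (τ - 1) (T - τ) = d → ∀ ε,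
      S.network hρ h1 hτ hs ε ∈ networkClass n T r κ c C := by
    intro τ h1 hτ hd ε
    refine S.network_mem_networkClass hρ hs hr hκ hcC hl0 h1 hτ ?_ ε
    rw [hd, hcard, hρdef, ← hl]
    push_cast
    field_simp
  exact S.quarter_le_of_normalizedRisk_le hρ hs est (τ := 1 + d) (τ' := T - d) (d := d)
    (by omega) (by omega) (by omega) (by omega) (by omega) (by omega) (by omega) hd0 hθ
    (fun ε => le_iSup₂_of_le _ (hmem _ _ (by omega) ε) le_rfl)
    (fun ε => le_iSup₂_of_le _ (hmem _ _ (by omega) ε) le_rfl)
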